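/- Graphs are finite, without isolated vertices, and are identified with their edge sets; $v(G)$ is the number of vertices of $G$. A \emph{graph matroid} $\mathcal{M}_n$ is a matroid on the ground set $\binom{[n]}{2}$ of edges of the complete graph on $[n]$; it is \emph{symmetric} if every isomorphic copy on $[n]$ of an $\mathcal{M}_n$-independent graph is $\mathcal{M}_n$-independent. A \emph{$2$-rigidity family} is a sequence $\mathcal{M}=(\mathcal{M}_n)_{n\ge 2}$ of symmetric graph matroids such that each $\mathcal{M}_n$ has rank $2n-3$ and every graph $G$ having a copy that is independent in $\mathcal{M}_m$ for some $m \geq 2$ has an independent copy in $\mathcal{M}_n$ (equivalently, by symmetry, all its copies on $[n]$ are independent) for every $n\ge \max(2, v(G))$. A graph $G$ is an \emph{$\mathcal{M}$-circuit} if for every $n\ge 2$ every copy of $G$ on $[n]$ is a circuit of $\mathcal{M}_n$. The generic plane rigidity family $\mathcal{R}=(\mathcal{R}_n)_{n\ge 2}$ is defined by: $G\subseteq\binom{[n]}{2}$ is $\mathcal{R}_n$-independent if and only if every set of $m$ vertices of $[n]$, $2\le m\le n$, induces at most $2m-3$ edges of $G$. Theorem. In every $2$-rigidity family $\mathcal{M}\ne\mathcal{R}$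 the complete bipartite graph $K_{3,3}$ is an $\mathcal{M}$-circuit. Moreover, $\mathcal{R}$ is itself a $2$-rigidity family in which $K_{3,3}$ is not a circuit, so that $\mathcal{R}$ is the unique $2$-rigidity family in which $K_{3,3}$ is not a circuit. -/

import Mathlib

namespace PlaneRigidity

/-- The set `V(G)` of (non-isolated) vertices of a graph `G`, given as a set of edges. -/
def vertices (G : Set (Sym2 ℕ)) : Set ℕ :=
  {v | ∃ e ∈ G, v ∈ e}

/-- The edge set of the complete graph on the `n` vertices `0, …, n - 1`. -/
def completeEdges (n : ℕ) : Set (Sym2 ℕ) :=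
  {e | ¬ e.IsDiag ∧ ∀ v ∈ e, v < n}

/-- `G'` is an isomorphic copy of `G` (graphs without isolated vertices, given as edge sets). -/
def IsCopy (G G' : Set (Sym2 ℕ)) : Prop :=
  ∃ f : ℕ → ℕ, Set.InjOn f (vertices G) ∧ G' = Sym2.map f '' G

/-- `M` is a symmetric graph matroid on the vertex set `{0, …, n - 1}`: its ground set consists
of all pairs of vertices, and independence is invariant under graph isomorphism. -/
structure IsSymmetricGraphMatroid (n : ℕ) (M : Matroid (Sym2 ℕ)) : Prop where
  ground_eq : M.E = completeEdges n
  symmetric : ∀ G G' : Set (Sym2 ℕ), M.Indep G → IsCopy G G' → G' ⊆ completeEdges n → M.Indep G'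

/-- Some isomorphic copy of `G` is independent in `M`. For a symmetric graph matroid this is the
same as all copies of `G` inside the ground set being independent, if there are any. -/
def HasIndepCopy (M : Matroid (Sym2 ℕ)) (G : Set (Sym2 ℕ)) : Prop :=
  ∃ G', IsCopy G G' ∧ M.Indep G'

/-- A sequence `(M n)`, `n ≥ n₀`, of symmetric graph matroids is a matroidal family if every graph
that is independent in some `M m` is independent in all `M n` with `n ≥ v(G)`. -/
structure IsMatroidalFamily (n₀ : ℕ) (M : {n : ℕ // n₀ ≤ n} → Matroid (Sym2 ℕ)) : Prop where
  symmetricGraphMatroid : ∀ n, IsSymmetricGraphMatroid n.1 (M n)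
  hereditary : ∀ (G : Set (Sym2 ℕ)) (m n : {n : ℕ // n₀ ≤ n}),
    HasIndepCopy (M m) G → (vertices G).encard ≤ (n.1 : ℕ∞) → HasIndepCopy (M n) G

/-- A `2`-rigidity family is a matroidal family `(M n)`, `n ≥ 2`, in which `M n` has
rank `2 n - 3`. -/
structure IsTwoRigidityFamily (M : {n : ℕ // 2 ≤ n} → Matroid (Sym2 ℕ)) : Prop where
  matroidalFamily : IsMatroidalFamily 2 M
  rank_eq : ∀ n, (M n).eRank = ((2 * n.1 - 3 : ℕ) : ℕ∞)

/-- The finite graph `G` is a circuit of the family `M`: every copy of `G` on the vertex set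
`{0, …, n - 1}` is a circuit of `M n`, for all `n`. -/
def IsFamilyCircuit (M : {n : ℕ // 2 ≤ n} → Matroid (Sym2 ℕ)) (G : Set (Sym2 ℕ)) : Prop :=
  ∀ (n : {n : ℕ // 2 ≤ n}) (G' : Set (Sym2 ℕ)),
    IsCopy G G' → G' ⊆ completeEdges n.1 → (M n).IsCircuit G'

/-- The complete bipartite graph `K_{3,3}`, with parts `{0, 1, 2}` and `{3, 4, 5}`. -/
def K33 : Set (Sym2 ℕ) :=
  {e | ∃ i j : ℕ, i < 3 ∧ 3 ≤ j ∧ j < 6 ∧ e = s(i, j)}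

/-- The edges of `G` induced by the vertex set `X`. -/
def induced (G : Set (Sym2 ℕ)) (X : Finset ℕ) : Set (Sym2 ℕ) :=
  {e ∈ G | ∀ v ∈ e, v ∈ X}

/-- The Pollaczek-Geiringer-Laman condition: `G` is a graph on `{0, …, n - 1}` and every set
of `m ≥ 2` vertices induces at most `2 m - 3` edges of `G`. -/
def IsLaman (n : ℕ) (G : Set (Sym2 ℕ)) : Prop :=
  G ⊆ completeEdges n ∧
    ∀ X : Finset ℕ, X ⊆ Finset.range n → 2 ≤ X.card → (induced G X).ncard ≤ 2 * X.card - 3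

theorem completeEdges_finite (n : ℕ) : (completeEdges n).Finite := by
  refine ((Finset.range n).sym2.finite_toSet).subset ?_
  intro e he
  simp only [Finset.mem_coe, Finset.mem_sym2_iff, Finset.mem_range]
  exact he.2

theorem induced_subset (G : Set (Sym2 ℕ)) (X : Finset ℕ) : induced G X ⊆ G := fun _ h => h.1

theorem isLaman_empty (n : ℕ) : IsLaman n ∅ := by
  refine ⟨Set.empty_subset _, fun X _ _ => ?_⟩
  have : induced ∅ X = ∅ := Set.subset_eq_empty (induced_subset _ _) rfl
  simp [this]

theorem IsLaman.subset {n : ℕ} {I J : Set (Sym2 ℕ)} (hJ : IsLaman n J) (hIJ : I ⊆ J) :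
    IsLaman n I := by
  refine ⟨hIJ.trans hJ.1, fun X hX h2 => le_trans (Set.ncard_le_ncard ?_ ?_) (hJ.2 X hX h2)⟩
  · exact fun e he => ⟨hIJ he.1, he.2⟩
  · exact ((completeEdges_finite n).subset hJ.1).subset (induced_subset _ _)

/-- `X` is tight for `I`: it induces exactly `2 |X| - 3` edges. -/
def IsTight (n : ℕ) (I : Set (Sym2 ℕ)) (X : Finset ℕ) : Prop :=
  X ⊆ Finset.range n ∧ 2 ≤ X.card ∧ (induced I X).ncard = 2 * X.card - 3

theorem IsTight.union {n : ℕ} {I : Set (Sym2 ℕ)} (hI : IsLaman n I) {X Y : Finset ℕ}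
    (hX : IsTight n I X) (hY : IsTight n I Y) (hXY : 2 ≤ (X ∩ Y).card) :
    IsTight n I (X ∪ Y) := by
  have hfin : I.Finite := (completeEdges_finite n).subset hI.1
  have hf : ∀ Z, (induced I Z).Finite := fun Z => hfin.subset (induced_subset _ _)
  have hsub : X ∪ Y ⊆ Finset.range n := Finset.union_subset hX.1 hY.1
  have h2 : 2 ≤ (X ∪ Y).card := hX.2.1.trans (Finset.card_le_card Finset.subset_union_left)
  have h1 := hI.2 _ hsub h2
  have h3 := hI.2 (X ∩ Y) (Finset.inter_subset_left.trans hX.1) hXY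
  have h4 := Finset.card_union_add_card_inter X Y
  have h5 := Set.ncard_union_add_ncard_inter (induced I X) (induced I Y) (hf X) (hf Y)
  have h6 : (induced I X ∪ induced I Y).ncard ≤ (induced I (X ∪ Y)).ncard := by
    refine Set.ncard_le_ncard ?_ (hf _)
    rintro e (he | he)
    · exact ⟨he.1, fun v hv => Finset.mem_union_left _ (he.2 v hv)⟩
    · exact ⟨he.1, fun v hv => Finset.mem_union_right _ (he.2 v hv)⟩
  have h7 : induced I X ∩ induced I Y = induced I (X ∩ Y) := by
    ext e
    simp only [induced, Set.mem_inter_iff, Set.mem_ofPred_eq, Finset.mem_inter]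
    exact ⟨fun h => ⟨h.1.1, fun v hv => ⟨h.1.2 v hv, h.2.2 v hv⟩⟩,
      fun h => ⟨⟨h.1, fun v hv => (h.2 v hv).1⟩, ⟨h.1, fun v hv => (h.2 v hv).2⟩⟩⟩
  rw [h7] at h5
  have h8 := hX.2.2
  have h9 := hY.2.2
  have h10 := hX.2.1
  have h11 := hY.2.1
  exact ⟨hsub, h2, by omega⟩

theorem two_le_card_of_edge {e : Sym2 ℕ} (he : ¬ e.IsDiag) {X : Finset ℕ}
    (hX : ∀ v ∈ e, v ∈ X) : 2 ≤ X.card := by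
  induction e with
  | h u v =>
    have huv : u ≠ v := by simpa using he
    have : ({u, v} : Finset ℕ) ⊆ X := by
      intro w hw
      simp only [Finset.mem_insert, Finset.mem_singleton] at hw
      rcases hw with rfl | rfl
      · exact hX _ (by simp)
      · exact hX _ (by simp)
    calc 2 = ({u, v} : Finset ℕ).card := (Finset.card_pair huv).symm
      _ ≤ X.card := Finset.card_le_card this

theorem exists_tight_of_not_isLaman_insert {n : ℕ} {I : Set (Sym2 ℕ)} (hI : IsLaman n I)
    {e : Sym2 ℕ} (he : e ∈ completeEdges n) (h : ¬ IsLaman n (insert e I)) :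
    ∃ X, IsTight n I X ∧ ∀ v ∈ e, v ∈ X := by
  have hfin : I.Finite := (completeEdges_finite n).subset hI.1
  have h' : ∃ X : Finset ℕ, X ⊆ Finset.range n ∧ 2 ≤ X.card ∧
      2 * X.card - 3 < (induced (insert e I) X).ncard := by
    by_contra hc
    push Not at hc
    exact h ⟨Set.insert_subset he hI.1, hc⟩
  obtain ⟨X, hX, h2, hlt⟩ := h'
  have hb := hI.2 X hX h2
  have hsub : induced (insert e I) X ⊆ insert e (induced I X) := by
    rintro f ⟨hf | hf, hfX⟩
    · exact Or.inl hf
    · exact Or.inr ⟨hf, hfX⟩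
  have hle := Set.ncard_le_ncard hsub ((hfin.subset (induced_subset _ _)).insert e)
  have hle' := Set.ncard_insert_le e (induced I X)
  refine ⟨X, ⟨hX, h2, by omega⟩, ?_⟩
  by_contra hne
  have hsub' : induced (insert e I) X ⊆ induced I X := by
    rintro f ⟨hf | hf, hfX⟩
    · subst hf
      exact absurd hfX hne
    · exact ⟨hf, hfX⟩
  have := Set.ncard_le_ncard hsub' (hfin.subset (induced_subset _ _))
  omega

theorem IsLaman.aug {n : ℕ} {I J : Set (Sym2 ℕ)} (hI : IsLaman n I) (hJ : IsLaman n J)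
    (hIJ : I.ncard < J.ncard) : ∃ e ∈ J, e ∉ I ∧ IsLaman n (insert e I) := by
  classical
  by_contra hcon
  push Not at hcon
  have hIfin : I.Finite := (completeEdges_finite n).subset hI.1
  have hJfin : J.Finite := (completeEdges_finite n).subset hJ.1
  have hcov : ∀ e ∈ J, ∃ X, IsTight n I X ∧ ∀ v ∈ e, v ∈ X := by
    intro e he
    by_cases heI : e ∈ I
    · have hec := hI.1 heI
      refine ⟨e.toFinset, ⟨?_, ?_, ?_⟩, fun v hv => by simpa using hv⟩
      · intro v hv
        simpa using hec.2 v (by simpa using hv)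
      · exact two_le_card_of_edge hec.1 (fun v hv => by simpa using hv)
      · have hc := Sym2.card_toFinset_of_not_isDiag e hec.1
        have hr : e.toFinset ⊆ Finset.range n := by
          intro v hv
          simpa using hec.2 v (by simpa using hv)
        have hu := hI.2 e.toFinset hr hc.ge
        have hmem : e ∈ induced I e.toFinset := ⟨heI, fun v hv => by simpa using hv⟩
        have hpos := (Set.ncard_pos (hIfin.subset (induced_subset I e.toFinset))).2 ⟨e, hmem⟩
        omega
    · exact exists_tight_of_not_isLaman_insert hI (hJ.1 he) (hcon e he heI)
  set T : Finset (Finset ℕ) :=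
    (Finset.range n).powerset.filter (fun X => Maximal (IsTight n I) X) with hT
  have hTmem : ∀ X, X ∈ T ↔ Maximal (IsTight n I) X := by
    intro X
    simp only [hT, Finset.mem_filter, Finset.mem_powerset, and_iff_right_iff_imp]
    exact fun h => h.prop.1
  have hmax : ∀ e ∈ J, ∃ X ∈ T, ∀ v ∈ e, v ∈ X := by
    intro e he
    obtain ⟨X, hX, heX⟩ := hcov e he
    have hfinT : {Y | IsTight n I Y}.Finite :=
      ((Finset.range n).powerset.finite_toSet).subset
        (fun Y hY => Finset.mem_coe.2 (Finset.mem_powerset.2 hY.1))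
    obtain ⟨Y, hXY, hY⟩ := hfinT.exists_le_maximal hX
    exact ⟨Y, (hTmem Y).2 hY, fun v hv => hXY (heX v hv)⟩
  have hfI : ∀ X, (induced I X).Finite := fun X => hIfin.subset (induced_subset _ _)
  have hfJ : ∀ X, (induced J X).Finite := fun X => hJfin.subset (induced_subset _ _)
  have hJle : J.ncard ≤ ∑ X ∈ T, (induced J X).ncard := by
    have hs : hJfin.toFinset ⊆ T.biUnion (fun X => (hfJ X).toFinset) := by
      intro e he
      have heJ : e ∈ J := by simpa using he
      obtain ⟨X, hX, heX⟩ := hmax e heJ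
      exact Finset.mem_biUnion.2 ⟨X, hX, by simpa using ⟨heJ, heX⟩⟩
    calc J.ncard = hJfin.toFinset.card := Set.ncard_eq_toFinset_card J hJfin
      _ ≤ _ := Finset.card_le_card hs
      _ ≤ ∑ X ∈ T, (hfJ X).toFinset.card := Finset.card_biUnion_le
      _ = _ := Finset.sum_congr rfl (fun X _ => (Set.ncard_eq_toFinset_card _ (hfJ X)).symm)
  have hIge : ∑ X ∈ T, (induced I X).ncard ≤ I.ncard := by
    have hdis : ∀ X ∈ T, ∀ Y ∈ T, X ≠ Y →
        Disjoint (hfI X).toFinset (hfI Y).toFinset := by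
      intro X hX Y hY hne
      rw [Finset.disjoint_left]
      intro e heX heY
      have heX' : e ∈ induced I X := by simpa using heX
      have heY' : e ∈ induced I Y := by simpa using heY
      have h2 : 2 ≤ (X ∩ Y).card := two_le_card_of_edge (hI.1 heX'.1).1
        (fun v hv => Finset.mem_inter.2 ⟨heX'.2 v hv, heY'.2 v hv⟩)
      have hXm := (hTmem X).1 hX
      have hYm := (hTmem Y).1 hY
      have hu := IsTight.union hI hXm.prop hYm.prop h2
      have e1 : X = X ∪ Y := hXm.eq_of_le hu Finset.subset_union_left
      have e2 : Y = X ∪ Y := hYm.eq_of_le hu Finset.subset_union_right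
      exact hne (e1.trans e2.symm)
    calc ∑ X ∈ T, (induced I X).ncard = ∑ X ∈ T, (hfI X).toFinset.card :=
          Finset.sum_congr rfl (fun X _ => Set.ncard_eq_toFinset_card _ (hfI X))
      _ = (T.biUnion (fun X => (hfI X).toFinset)).card := (Finset.card_biUnion hdis).symm
      _ ≤ hIfin.toFinset.card := by
          refine Finset.card_le_card (Finset.biUnion_subset.2 fun X _ e he => ?_)
          have he' : e ∈ induced I X := by simpa using he
          simpa using he'.1
      _ = I.ncard := (Set.ncard_eq_toFinset_card I hIfin).symm
  have hle : ∑ X ∈ T, (induced J X).ncard ≤ ∑ X ∈ T, (induced I X).ncard := by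
    refine Finset.sum_le_sum fun X hX => ?_
    have ht := ((hTmem X).1 hX).prop
    rw [ht.2.2]
    exact hJ.2 X ht.1 ht.2.1
  omega

/-- The generic plane rigidity matroid on the vertex set `{0, …, n - 1}`. -/
def rigidityMatroid (n : ℕ) : Matroid (Sym2 ℕ) :=
  (IndepMatroid.ofFinite (E := completeEdges n) (completeEdges_finite n) (IsLaman n)
    (isLaman_empty n) (fun _ _ hJ hIJ => hJ.subset hIJ)
    (fun _ _ hI hJ hIJ => hI.aug hJ hIJ) (fun _ hI => hI.1)).matroid

theorem rigidityMatroid_indep_iff (n : ℕ) (G : Set (Sym2 ℕ)) :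
    (rigidityMatroid n).Indep G ↔ IsLaman n G := by
  simp [rigidityMatroid]

theorem rigidityMatroid_ground (n : ℕ) : (rigidityMatroid n).E = completeEdges n := rfl

/-- The generic plane rigidity family. -/
def rigidityFamily : {n : ℕ // 2 ≤ n} → Matroid (Sym2 ℕ) :=
  fun n => rigidityMatroid n.1

end PlaneRigidity

/-! In a 2-rigidity family, `K_4` has six edges and rank 5, so by symmetry deleting any edge leaves
a basis. Hence a vertex joined by two edges to a spanned clique is itself spanned into it, and a
rank count shows that adding a vertex of degree 2 (0-extension) preserves independence. Consequently
`K_{3,3}` minus an edge is always independent, so a copy of `K_{3,3}` is either independent or a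
circuit. The rank of cliques also makes every independent set a Laman graph.

Suppose now that some copy of `K_{3,3}` is independent. It has 9 = 2·6 - 3 edges, so it spans the
complete graph on its six vertices. This makes 1-extension (delete `ab`, join a new vertex to `a`,
`b`, `c`) preserve independence: if it failed, three clones of the new vertex, each attached only to
`a` and `b`, would span a `K_{3,3}` and hence `ab`, giving a spanning set one edge smaller than the
rank (`indep_oneExtension`).

A Laman graph has a vertex of degree at most 3, so Henneberg induction with 0- and 1-extensions
shows that every Laman graph is independent (`indep_of_isLaman`). Therefore the family is the plane
rigidity family. Conversely `K_{3,3}` satisfies the Laman count, so it is not a circuit there. -/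

namespace PlaneRigidity

/-! ### Isomorphic copies of edge sets -/

theorem injOn_sym2_map {f : ℕ → ℕ} {G : Set (Sym2 ℕ)} (hf : Set.InjOn f (vertices G)) :
    Set.InjOn (Sym2.map f) G := by
  intro e he e' he' h
  induction e with
  | h a b =>
    induction e' with
    | h c d =>
      have ha : a ∈ vertices G := ⟨_, he, by simp⟩
      have hb : b ∈ vertices G := ⟨_, he, by simp⟩
      have hc : c ∈ vertices G := ⟨_, he', by simp⟩
      have hd : d ∈ vertices G := ⟨_, he', by simp⟩
      simp only [Sym2.map_mk, Sym2.eq_iff] at h ⊢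
      rcases h with ⟨h1, h2⟩ | ⟨h1, h2⟩
      · exact Or.inl ⟨hf ha hc h1, hf hb hd h2⟩
      · exact Or.inr ⟨hf ha hd h1, hf hb hc h2⟩

theorem vertices_map (f : ℕ → ℕ) (G : Set (Sym2 ℕ)) :
    vertices (Sym2.map f '' G) = f '' vertices G := by
  ext v
  constructor
  · rintro ⟨_, ⟨e, he, rfl⟩, hv⟩
    obtain ⟨w, hw, rfl⟩ := Sym2.mem_map.1 hv
    exact ⟨w, ⟨e, he, hw⟩, rfl⟩
  · rintro ⟨w, ⟨e, he, hw⟩, rfl⟩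
    exact ⟨_, ⟨e, he, rfl⟩, Sym2.mem_map.2 ⟨w, hw, rfl⟩⟩

theorem isCopy_refl (G : Set (Sym2 ℕ)) : IsCopy G G :=
  ⟨id, Function.injective_id.injOn, by simp⟩

theorem isCopy_map {f : ℕ → ℕ} (hf : f.Injective) (G : Set (Sym2 ℕ)) :
    IsCopy G (Sym2.map f '' G) :=
  ⟨f, hf.injOn, rfl⟩

theorem IsCopy.trans {G H K : Set (Sym2 ℕ)} (h : IsCopy G H) (h' : IsCopy H K) :
    IsCopy G K := by
  obtain ⟨f, hf, rfl⟩ := h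
  obtain ⟨g, hg, rfl⟩ := h'
  rw [vertices_map] at hg
  refine ⟨g ∘ f, fun x hx y hy hxy => hf hx hy (hg ⟨x, hx, rfl⟩ ⟨y, hy, rfl⟩ hxy), ?_⟩
  rw [Sym2.map_comp, Set.image_comp]

theorem IsCopy.symm {G H : Set (Sym2 ℕ)} (h : IsCopy G H) : IsCopy H G := by
  obtain ⟨f, hf, rfl⟩ := h
  have hinv : ∀ v ∈ vertices G, Function.invFunOn f (vertices G) (f v) = v :=
    fun v hv => hf.leftInvOn_invFunOn hv
  refine ⟨Function.invFunOn f (vertices G), ?_, ?_⟩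
  · rw [vertices_map]
    rintro _ ⟨x, hx, rfl⟩ _ ⟨y, hy, rfl⟩ h
    rw [hinv x hx, hinv y hy] at h
    rw [h]
  · rw [← Set.image_comp, ← Sym2.map_comp]
    refine (Set.EqOn.image_eq_self fun e he => ?_).symm
    have : Sym2.map (Function.invFunOn f (vertices G) ∘ f) e = Sym2.map id e :=
      Sym2.map_congr fun v hv => hinv v ⟨e, he, hv⟩
    simpa using this

theorem IsCopy.encard_eq {G H : Set (Sym2 ℕ)} (h : IsCopy G H) : H.encard = G.encard := by
  obtain ⟨f, hf, rfl⟩ := h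
  exact (injOn_sym2_map hf).encard_image

theorem IsCopy.encard_vertices_eq {G H : Set (Sym2 ℕ)} (h : IsCopy G H) :
    (vertices H).encard = (vertices G).encard := by
  obtain ⟨f, hf, rfl⟩ := h
  rw [vertices_map]
  exact hf.encard_image

/-! ### Cliques and transport of independence -/

/-- The edge set of the complete graph on `X`. -/
def clique (X : Finset ℕ) : Set (Sym2 ℕ) :=
  {e | ¬ e.IsDiag ∧ ∀ v ∈ e, v ∈ X}

theorem completeEdges_eq_clique (n : ℕ) : completeEdges n = clique (Finset.range n) := by
  simp [completeEdges, clique]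

theorem mk_mem_clique {X : Finset ℕ} {a b : ℕ} :
    s(a, b) ∈ clique X ↔ a ≠ b ∧ a ∈ X ∧ b ∈ X := by
  simp [clique]

theorem clique_mono {X Y : Finset ℕ} (h : X ⊆ Y) : clique X ⊆ clique Y :=
  fun _ he => ⟨he.1, fun v hv => h (he.2 v hv)⟩

theorem clique_subset_completeEdges {X : Finset ℕ} {n : ℕ} (h : X ⊆ Finset.range n) :
    clique X ⊆ completeEdges n := by
  rw [completeEdges_eq_clique]
  exact clique_mono h

theorem clique_finite (X : Finset ℕ) : (clique X).Finite :=
  X.sym2.finite_toSet.subset fun _ he => Finset.mem_coe.2 (Finset.mem_sym2_iff.2 he.2)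

theorem vertices_subset_of_subset_clique {X : Finset ℕ} {G : Set (Sym2 ℕ)} (h : G ⊆ clique X) :
    vertices G ⊆ X := by
  rintro v ⟨e, he, hv⟩
  exact (h he).2 v hv

theorem map_subset_clique {f : ℕ → ℕ} {X Y : Finset ℕ} {G : Set (Sym2 ℕ)} (hG : G ⊆ clique X)
    (hf : Set.InjOn f X) (hXY : ∀ x ∈ X, f x ∈ Y) : Sym2.map f '' G ⊆ clique Y := by
  rintro _ ⟨e, he, rfl⟩
  have h := hG he
  induction e with
  | h a b =>
    obtain ⟨h1, h2, h3⟩ := mk_mem_clique.1 h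
    rw [Sym2.map_mk, mk_mem_clique]
    exact ⟨fun h => h1 (hf h2 h3 h), hXY a h2, hXY b h3⟩

theorem encard_vertices_le {n : ℕ} {G : Set (Sym2 ℕ)} (h : G ⊆ completeEdges n) :
    (vertices G).encard ≤ n := by
  rw [completeEdges_eq_clique] at h
  refine (Set.encard_le_encard (vertices_subset_of_subset_clique h)).trans ?_
  rw [Set.encard_coe_eq_coe_finsetCard, Finset.card_range]

/-- Heredity supplies only some independent copy in `M n`; symmetry then moves it onto the
prescribed copy `G'`. -/
theorem IsMatroidalFamily.indep_of_isCopy {n₀ : ℕ} {M : {n : ℕ // n₀ ≤ n} → Matroid (Sym2 ℕ)}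
    (hM : IsMatroidalFamily n₀ M) {m n : {n : ℕ // n₀ ≤ n}} {G G' : Set (Sym2 ℕ)}
    (hG : (M m).Indep G) (h : IsCopy G G') (hG' : G' ⊆ completeEdges n.1) : (M n).Indep G' := by
  obtain ⟨H, hH, hHi⟩ := hM.hereditary G m n ⟨G, isCopy_refl G, hG⟩
    (h.encard_vertices_eq ▸ encard_vertices_le hG')
  exact (hM.symmetricGraphMatroid n).symmetric H G' hHi (hH.symm.trans h) hG'

/-! ### Rank of cliques and the `K_4` circuit -/

namespace IsTwoRigidityFamily

variable {M : {n : ℕ // 2 ≤ n} → Matroid (Sym2 ℕ)} (hM : IsTwoRigidityFamily M)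
  {m n : {n : ℕ // 2 ≤ n}}

include hM

theorem ground_eq (n : {n : ℕ // 2 ≤ n}) : (M n).E = completeEdges n.1 :=
  (hM.matroidalFamily.symmetricGraphMatroid n).ground_eq

theorem indep_of_isCopy {G G' : Set (Sym2 ℕ)} (hG : (M m).Indep G) (h : IsCopy G G')
    (hG' : G' ⊆ completeEdges n.1) : (M n).Indep G' :=
  hM.matroidalFamily.indep_of_isCopy hG h hG'

theorem clique_subset_ground {X : Finset ℕ} (hX : X ⊆ Finset.range n.1) : clique X ⊆ (M n).E := by
  rw [hM.ground_eq]
  exact clique_subset_completeEdges hX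

/-- Relabelling `X` by `0, …, |X| - 1` matches independent sets with those of `M |X|`, whose rank is
prescribed. -/
theorem eRk_clique {X : Finset ℕ} (hX : X ⊆ Finset.range n.1) (h2 : 2 ≤ X.card) :
    (M n).eRk (clique X) = ((2 * X.card - 3 : ℕ) : ℕ∞) := by
  rw [← hM.rank_eq ⟨X.card, h2⟩]
  apply le_antisymm
  · rw [Matroid.eRk_le_iff]
    intro I hIX hI
    obtain ⟨f, hfX, hf⟩ := Set.Finite.exists_injOn_of_encard_le (s := (X : Set ℕ))
      (t := (Finset.range X.card : Set ℕ)) X.finite_toSet (by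
        rw [Set.encard_coe_eq_coe_finsetCard, Set.encard_coe_eq_coe_finsetCard, Finset.card_range])
    have hc : IsCopy I (Sym2.map f '' I) :=
      ⟨f, hf.mono (vertices_subset_of_subset_clique hIX), rfl⟩
    rw [← hc.encard_eq]
    refine (hM.indep_of_isCopy hI hc ?_).encard_le_eRank
    rw [completeEdges_eq_clique]
    exact map_subset_clique hIX hf fun x hx => by simpa using hfX hx
  · obtain ⟨B, hB⟩ := (M ⟨X.card, h2⟩).exists_isBase
    rw [← hB.encard_eq_eRank]
    obtain ⟨f, hfX, hf⟩ := Set.Finite.exists_injOn_of_encard_le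
      (s := (Finset.range X.card : Set ℕ)) (t := (X : Set ℕ)) (Finset.finite_toSet _) (by
        rw [Set.encard_coe_eq_coe_finsetCard, Set.encard_coe_eq_coe_finsetCard, Finset.card_range])
    have hBX : B ⊆ clique (Finset.range X.card) := by
      rw [← completeEdges_eq_clique]
      exact hM.ground_eq ⟨X.card, h2⟩ ▸ hB.subset_ground
    have hc : IsCopy B (Sym2.map f '' B) :=
      ⟨f, hf.mono (vertices_subset_of_subset_clique hBX), rfl⟩
    have hs := map_subset_clique (Y := X) hBX hf fun x hx => by simpa using hfX hx
    rw [← hc.encard_eq]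
    exact (hM.indep_of_isCopy hB.indep hc
      (hs.trans (clique_subset_completeEdges hX))).encard_le_eRk_of_subset hs

/-- Six edges and rank 5 mean that deleting a suitable edge of `K_4` leaves a basis. Permutations of
the vertices act transitively on the edges, so deleting `ab` does too. -/
theorem mk_mem_closure_of_four {a b c d : ℕ} (hX : {a, b, c, d} ⊆ Finset.range n.1)
    (hab : a ≠ b) (hac : a ≠ c) (had : a ≠ d) (hbc : b ≠ c) (hbd : b ≠ d) (hcd : c ≠ d) :
    s(a, b) ∈ (M n).closure {s(a, c), s(a, d), s(b, c), s(b, d), s(c, d)} := by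
  set X : Finset ℕ := {a, b, c, d} with hXdef
  have hcard : X.card = 4 := by simp [hXdef, hab, hac, had, hbc, hbd, hcd]
  have hrk := hM.eRk_clique hX (by omega)
  rw [hcard] at hrk
  have hcl : clique X = {s(a, b), s(a, c), s(a, d), s(b, c), s(b, d), s(c, d)} := by
    ext e
    induction e with
    | h p q =>
      rw [mk_mem_clique]
      simp only [hXdef, Finset.mem_insert, Finset.mem_singleton, Set.mem_insert_iff,
        Set.mem_singleton_iff, Sym2.eq_iff]
      constructor
      · rintro ⟨h, rfl | rfl | rfl | rfl, rfl | rfl | rfl | rfl⟩ <;> simp_all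
      · rintro ((⟨rfl, rfl⟩ | ⟨rfl, rfl⟩) | (⟨rfl, rfl⟩ | ⟨rfl, rfl⟩) | (⟨rfl, rfl⟩ | ⟨rfl, rfl⟩) |
          (⟨rfl, rfl⟩ | ⟨rfl, rfl⟩) | (⟨rfl, rfl⟩ | ⟨rfl, rfl⟩) | (⟨rfl, rfl⟩ | ⟨rfl, rfl⟩)) <;>
        simp_all [Ne.symm]
  have hcl' : clique X \ {s(a, b)} = {s(a, c), s(a, d), s(b, c), s(b, d), s(c, d)} := by
    rw [hcl, Set.insert_sdiff_of_mem _ (Set.mem_singleton _), Set.sdiff_singleton_eq_self]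
    simp [hab, hac, had, hbc, hbd, hab.symm]
  rw [← hcl']
  have hXE := hM.clique_subset_ground hX
  have habX : s(a, b) ∈ clique X := by simp [hcl]
  have hsix : (clique X).encard = 6 := by
    rw [hcl]
    repeat rw [Set.encard_insert_of_notMem (by simp; grind)]
    rw [Set.encard_singleton]
    norm_num
  obtain ⟨I, hI⟩ := (M n).exists_isBasis (clique X) hXE
  have hI5 : I.encard = 5 := by rw [hI.encard_eq_eRk, hrk]; norm_num
  have h1 := Set.encard_sdiff_add_encard_of_subset hI.subset
  rw [hsix, hI5] at h1
  have h1' : (clique X \ I).encard = 1 := by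
    generalize (clique X \ I).encard = k at h1
    have h6 : (1 : ℕ∞) + 5 = 6 := by norm_num
    rw [← h6] at h1
    exact WithTop.add_right_cancel (ENat.natCast_ne_top 5) h1
  obtain ⟨e, he⟩ := Set.encard_eq_one.1 h1'
  have heI : I = clique X \ {e} := by rw [← he, Set.sdiff_sdiff_cancel_left hI.subset]
  have heX : e ∈ clique X := by
    have : e ∈ clique X \ I := by rw [he]; rfl
    exact this.1
  have key : (M n).Indep (clique X \ {s(a, b)}) := by
    induction e with
    | h p q =>
      obtain ⟨hpq, hp, hq⟩ := mk_mem_clique.1 heX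
      have hswap : ∀ x y : ℕ, x ∈ X → y ∈ X → ∀ z ∈ X, Equiv.swap x y z ∈ X := by
        intro x y hx hy z hz
        rw [Equiv.swap_apply_def]
        split_ifs <;> assumption
      set q' := Equiv.swap p a q with hq'
      have haX : a ∈ X := by simp [hXdef]
      have hbX : b ∈ X := by simp [hXdef]
      have hq'X : q' ∈ X := hswap p a hp haX q hq
      have hq'a : a ≠ q' := by
        intro h
        exact hpq ((Equiv.swap p a).injective ((Equiv.swap_apply_left p a).trans h))
      -- The first swap sends `p` to `a` and `q` to `q'`; the second sends `q'` to `b` and fixes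
      -- `a`. So the omitted edge `pq` goes to `ab`.
      set σ : Equiv.Perm ℕ := Equiv.swap q' b * Equiv.swap p a with hσ
      have hσX : ∀ z ∈ X, σ z ∈ X := fun z hz => hswap _ _ hq'X hbX _ (hswap _ _ hp haX _ hz)
      have hσp : σ p = a := by
        rw [hσ, Equiv.Perm.mul_apply, Equiv.swap_apply_left, Equiv.swap_apply_of_ne_of_ne hq'a hab]
      have hσq : σ q = b := by
        rw [hσ, Equiv.Perm.mul_apply, ← hq', Equiv.swap_apply_left]
      have hinj : Function.Injective (Sym2.map σ) := Sym2.map.injective σ.injective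
      have him : Sym2.map σ '' clique X ⊆ clique X :=
        map_subset_clique subset_rfl σ.injective.injOn hσX
      have him' : Sym2.map σ '' clique X = clique X :=
        ((clique_finite X).image _).eq_of_subset_of_encard_le him (by rw [hinj.encard_image])
      have himI : Sym2.map σ '' I = clique X \ {s(a, b)} := by
        rw [heI, Set.image_sdiff hinj, him', Set.image_singleton, Sym2.map_mk, hσp, hσq]
      rw [← himI]
      refine hM.indep_of_isCopy hI.indep (isCopy_map σ.injective I) ?_
      rw [himI]
      exact Set.sdiff_subset.trans (clique_subset_completeEdges hX)
  have hbas : (M n).IsBasis (clique X \ {s(a, b)}) (clique X) := by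
    refine key.isBasis_of_eRk_ge ((clique_finite X).subset Set.sdiff_subset) Set.sdiff_subset ?_ hXE
    rw [key.eRk_eq_encard, hrk]
    have := Set.encard_sdiff_singleton_add_one habX
    rw [hsix] at this
    generalize (clique X \ {s(a, b)}).encard = k at this
    have h6 : (5 : ℕ∞) + 1 = 6 := by norm_num
    rw [← h6] at this
    exact (WithTop.add_right_cancel (ENat.natCast_ne_top 1) this).ge
  exact hbas.subset_closure habX

end IsTwoRigidityFamily
end PlaneRigidity

/-! ### 0-extensions and 1-extensions -/

namespace PlaneRigidity

/-- The edge set of the complete bipartite graph with parts `A` and `B`. -/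
def biclique (A B : Set ℕ) : Set (Sym2 ℕ) :=
  {e | ∃ a ∈ A, ∃ b ∈ B, e = s(a, b)}

theorem mk_mem_biclique {A B : Set ℕ} {a b : ℕ} (ha : a ∈ A) (hb : b ∈ B) :
    s(a, b) ∈ biclique A B :=
  ⟨a, ha, b, hb, rfl⟩

theorem map_biclique (f : ℕ → ℕ) (A B : Set ℕ) :
    Sym2.map f '' biclique A B = biclique (f '' A) (f '' B) := by
  ext e
  constructor
  · rintro ⟨_, ⟨a, ha, b, hb, rfl⟩, rfl⟩
    exact mk_mem_biclique (Set.mem_image_of_mem f ha) (Set.mem_image_of_mem f hb)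
  · rintro ⟨_, ⟨a, ha, rfl⟩, _, ⟨b, hb, rfl⟩, rfl⟩
    exact ⟨_, mk_mem_biclique ha hb, rfl⟩

theorem insert_mk_subset_clique {X : Finset ℕ} {G : Set (Sym2 ℕ)} (hG : G ⊆ clique X) {a b : ℕ}
    (hab : a ≠ b) (ha : a ∈ X) (hb : b ∈ X) : insert s(a, b) G ⊆ clique X :=
  Set.insert_subset (mk_mem_clique.2 ⟨hab, ha, hb⟩) hG

namespace IsTwoRigidityFamily

variable {M : {n : ℕ // 2 ≤ n} → Matroid (Sym2 ℕ)} (hM : IsTwoRigidityFamily M)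
  {n : {n : ℕ // 2 ≤ n}}

include hM

/-- For any other `q` in `X`, the closure contains `K_4` on `v, q, a, b` except possibly `vq`, hence
also `vq`. -/
theorem clique_insert_subset_closure {X : Finset ℕ} (hX : X ⊆ Finset.range n.1) {v a b : ℕ}
    (hv : v < n.1) (hvX : v ∉ X) (ha : a ∈ X) (hb : b ∈ X) (hab : a ≠ b) {S : Set (Sym2 ℕ)}
    (hS : clique X ⊆ (M n).closure S) (hva : s(v, a) ∈ (M n).closure S)
    (hvb : s(v, b) ∈ (M n).closure S) : clique (insert v X) ⊆ (M n).closure S := by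
  have key : ∀ q ∈ X, s(v, q) ∈ (M n).closure S := by
    intro q hq
    by_cases hqa : q = a
    · rwa [hqa]
    by_cases hqb : q = b
    · rwa [hqb]
    have hne : ∀ x ∈ X, v ≠ x := fun x hx h => hvX (h ▸ hx)
    have h4 := hM.mk_mem_closure_of_four (n := n) (a := v) (b := q) (c := a) (d := b) (by
      intro x hx
      simp only [Finset.mem_insert, Finset.mem_singleton] at hx
      rcases hx with rfl | rfl | rfl | rfl
      · simpa using hv
      all_goals exact hX (by assumption)) (hne q hq) (hne a ha) (hne b hb) hqa hqb hab
    refine (M n).closure_subset_closure_of_subset_closure ?_ h4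
    rintro e (rfl | rfl | rfl | rfl | rfl)
    · exact hva
    · exact hvb
    · exact hS (mk_mem_clique.2 ⟨hqa, hq, ha⟩)
    · exact hS (mk_mem_clique.2 ⟨hqb, hq, hb⟩)
    · exact hS (mk_mem_clique.2 ⟨hab, ha, hb⟩)
  intro e he
  induction e with
  | h p q =>
    obtain ⟨hpq, hp, hq⟩ := mk_mem_clique.1 he
    rcases Finset.mem_insert.1 hp with rfl | hp' <;>
      rcases Finset.mem_insert.1 hq with rfl | hq'
    · exact absurd rfl hpq
    · exact key q hq'
    · rw [Sym2.eq_swap]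
      exact key p hp'
    · exact hS (mk_mem_clique.2 ⟨hpq, hp', hq'⟩)

theorem le_encard_of_clique_subset_closure {X : Finset ℕ} (hX : X ⊆ Finset.range n.1)
    (h2 : 2 ≤ X.card) {S : Set (Sym2 ℕ)} (hS : clique X ⊆ (M n).closure S) :
    ((2 * X.card - 3 : ℕ) : ℕ∞) ≤ (M n).eRk S := by
  rw [← hM.eRk_clique hX h2, ← (M n).eRk_closure_eq S]
  exact (M n).eRk_mono hS

/-- Attaching a new vertex by two edges preserves independence. -/
theorem indep_zeroExtension {X : Finset ℕ} (hX : X ⊆ Finset.range n.1) {v a b : ℕ}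
    (hv : v < n.1) (hvX : v ∉ X) (ha : a ∈ X) (hb : b ∈ X) (hab : a ≠ b) {G : Set (Sym2 ℕ)}
    (hGX : G ⊆ clique X) (hG : (M n).Indep G) :
    (M n).Indep (insert s(v, a) (insert s(v, b) G)) := by
  have h2 : 2 ≤ X.card := by
    rw [← Finset.card_pair hab]
    exact Finset.card_le_card (by simp [Finset.insert_subset_iff, ha, hb])
  -- With `G` enlarged to a basis of the clique, adding two edges gives at most 2|X| - 1 edges
  -- spanning a clique of exactly that rank, so they are independent.
  obtain ⟨J, hJ, hGJ⟩ := hG.subset_isBasis_of_subset hGX (hM.clique_subset_ground hX)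
  set T := insert s(v, a) (insert s(v, b) J) with hT
  have hX' : insert v X ⊆ Finset.range n.1 := Finset.insert_subset (by simpa using hv) hX
  have hne : ∀ x ∈ X, v ≠ x := fun x hx h => hvX (h ▸ hx)
  have hTX : T ⊆ clique (insert v X) :=
    insert_mk_subset_clique (insert_mk_subset_clique
      (hJ.subset.trans (clique_mono (Finset.subset_insert _ _))) (hne b hb) (by simp)
      (by simp [hb])) (hne a ha) (by simp) (by simp [ha])
  have hTE := hTX.trans (hM.clique_subset_ground hX')
  have hTcl := (M n).subset_closure T hTE
  have hJT : J ⊆ T := (Set.subset_insert _ _).trans (Set.subset_insert _ _)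
  have hcl := hM.clique_insert_subset_closure hX hv hvX ha hb hab
    (hJ.subset_closure.trans ((M n).closure_subset_closure hJT)) (hTcl (by simp [hT]))
    (hTcl (by simp [hT]))
  have hle := hM.le_encard_of_clique_subset_closure hX' (by
    rw [Finset.card_insert_of_notMem hvX]; omega) hcl
  have hTfin : T.Finite := (clique_finite _).subset hTX
  have hTi : (M n).Indep T := by
    refine Matroid.IsRkFinite.indep_of_encard_le_eRk ((M n).isRkFinite_of_finite hTfin) ?_
    refine le_trans ?_ hle
    calc T.encard ≤ J.encard + 1 + 1 := (Set.encard_insert_le _ _).trans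
          (by gcongr; exact Set.encard_insert_le _ _)
      _ = ((2 * X.card - 3 + 1 + 1 : ℕ) : ℕ∞) := by
          rw [hJ.encard_eq_eRk, hM.eRk_clique hX h2]; push_cast; rfl
      _ ≤ _ := by
          rw [Finset.card_insert_of_notMem hvX]
          exact_mod_cast (by omega)
  exact hTi.subset (Set.insert_subset_insert (Set.insert_subset_insert hGJ))

/-- Swapping `v` and `w` fixes `G`, so an independent 3-star at `w` would give one at `v`. This
transfers a failed 1-extension to every clone of the new vertex. -/
theorem mem_closure_of_not_indep_star {X : Finset ℕ} (hX : X ⊆ Finset.range n.1) {v w a b c : ℕ}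
    (hv : v < n.1) (hvX : v ∉ X) (hw : w < n.1) (hwX : w ∉ X) (ha : a ∈ X) (hb : b ∈ X)
    (hc : c ∈ X) (hab : a ≠ b) {G : Set (Sym2 ℕ)} (hGX : G ⊆ clique X) (hG : (M n).Indep G)
    (hdep : ¬ (M n).Indep (insert s(v, c) (insert s(v, a) (insert s(v, b) G)))) :
    s(w, c) ∈ (M n).closure (insert s(w, a) (insert s(w, b) G)) := by
  have hne : ∀ x ∈ X, v ≠ x := fun x hx h => hvX (h ▸ hx)
  have hne' : ∀ x ∈ X, w ≠ x := fun x hx h => hwX (h ▸ hx)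
  have hE : ∀ u < n.1, u ∉ X → ∀ x ∈ X, s(u, x) ∈ (M n).E := by
    intro u hu huX x hx
    rw [hM.ground_eq, completeEdges_eq_clique, mk_mem_clique]
    exact ⟨fun h => huX (h ▸ hx), by simpa using hu, hX hx⟩
  by_contra hcl
  have h0 := hM.indep_zeroExtension hX hw hwX ha hb hab hGX hG
  have h1 := ((h0.notMem_closure_iff (hE w hw hwX c hc)).1 hcl).1
  refine hdep ?_
  have hfix : ∀ x ∈ X, Equiv.swap w v x = x := fun x hx =>
    Equiv.swap_apply_of_ne_of_ne (hne' x hx).symm (hne x hx).symm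
  have hGfix : Sym2.map (Equiv.swap w v) '' G = G := by
    refine Set.EqOn.image_eq_self fun e he => ?_
    have : Sym2.map (Equiv.swap w v) e = Sym2.map id e :=
      Sym2.map_congr fun x hx => hfix x ((hGX he).2 x hx)
    simpa using this
  have him : Sym2.map (Equiv.swap w v) '' insert s(w, c) (insert s(w, a) (insert s(w, b) G)) =
      insert s(v, c) (insert s(v, a) (insert s(v, b) G)) := by
    simp only [Set.image_insert_eq, Sym2.map_mk, Equiv.swap_apply_left, hfix a ha, hfix b hb,
      hfix c hc, hGfix]
  refine hM.indep_of_isCopy h1 (him ▸ isCopy_map (Equiv.swap w v).injective _) ?_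
  rw [← hM.ground_eq n]
  exact Set.insert_subset (hE v hv hvX c hc) (Set.insert_subset (hE v hv hvX a ha)
    (Set.insert_subset (hE v hv hvX b hb) (hGX.trans (hM.clique_subset_ground hX))))

/-- If a copy of `K_{3,3}` on `{a, b, c}` and three new vertices is independent, then replacing the
edge `ab` by three edges from a new vertex to `a`, `b`, `c` preserves independence. -/
theorem indep_oneExtension {X : Finset ℕ} (hX : X ⊆ Finset.range n.1) {u v w a b c : ℕ}
    (hu : u < n.1) (hv : v < n.1) (hw : w < n.1) (huX : u ∉ X) (hvX : v ∉ X) (hwX : w ∉ X)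
    (huv : u ≠ v) (huw : u ≠ w) (hvw : v ≠ w) (ha : a ∈ X) (hb : b ∈ X) (hc : c ∈ X)
    (hab : a ≠ b) (hac : a ≠ c) (hbc : b ≠ c) {G : Set (Sym2 ℕ)} (hGX : G ⊆ clique X)
    (habG : s(a, b) ∉ G) (hG : (M n).Indep (insert s(a, b) G))
    (h33 : (M n).Indep (biclique {a, b, c} {u, v, w})) :
    (M n).Indep (insert s(u, c) (insert s(u, a) (insert s(u, b) G))) := by
  have h2 : 2 ≤ X.card := by
    rw [← Finset.card_pair hab]
    exact Finset.card_le_card (by simp [Finset.insert_subset_iff, ha, hb])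
  have hneX : ∀ z ∉ X, ∀ x ∈ X, z ≠ x := fun z hz x hx h => hz (h ▸ hx)
  obtain ⟨J, hJ, hGJ⟩ := hG.subset_isBasis_of_subset (insert_mk_subset_clique hGX hab ha hb)
    (hM.clique_subset_ground hX)
  -- `H` contains `G` and is one edge short of a basis of the clique, so it has exactly 2|X| - 4
  -- edges.
  set H := J \ {s(a, b)} with hH
  have hGH : G ⊆ H := fun e he => ⟨hGJ (Or.inr he), fun h => habG (h ▸ he)⟩
  have hHX : H ⊆ clique X := Set.sdiff_subset.trans hJ.subset
  have hHi : (M n).Indep H := hJ.indep.subset Set.sdiff_subset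
  by_contra hcon
  have hdep : ¬ (M n).Indep (insert s(u, c) (insert s(u, a) (insert s(u, b) H))) := fun h =>
    hcon (h.subset (Set.insert_subset_insert (Set.insert_subset_insert
      (Set.insert_subset_insert hGH))))
  -- `S` has at most 2|X| + 2 edges. It will be shown to span the clique on `X ∪ {u, v, w}`, whose
  -- rank is 2(|X| + 3) - 3 = 2|X| + 3.
  set S : Set (Sym2 ℕ) := insert s(u, a) (insert s(u, b) (insert s(v, a) (insert s(v, b)
    (insert s(w, a) (insert s(w, b) H))))) with hS
  have hXuvw : insert u (insert v (insert w X)) ⊆ Finset.range n.1 := by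
    simp [Finset.insert_subset_iff, hu, hv, hw, hX]
  have hXvw : insert v (insert w X) ⊆ Finset.range n.1 := (Finset.subset_insert _ _).trans hXuvw
  have hXw : insert w X ⊆ Finset.range n.1 := (Finset.subset_insert _ _).trans hXvw
  have hXX : X ⊆ insert u (insert v (insert w X)) := fun x hx => by simp [hx]
  have hSE : S ⊆ (M n).E := by
    refine Set.Subset.trans ?_ (hM.clique_subset_ground hXuvw)
    refine insert_mk_subset_clique (insert_mk_subset_clique (insert_mk_subset_clique
      (insert_mk_subset_clique (insert_mk_subset_clique (insert_mk_subset_clique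
      (hHX.trans (clique_mono hXX)) ?_ ?_ ?_) ?_ ?_ ?_) ?_ ?_ ?_) ?_ ?_ ?_) ?_ ?_ ?_) ?_ ?_ ?_
    all_goals first
      | exact hneX _ (by assumption) _ (by assumption)
      | exact hXX (by assumption)
      | simp
  have hScl := (M n).subset_closure S hSE
  have hHS : H ⊆ S := fun e he => by simp [hS, he]
  have hstar : ∀ z ∈ ({u, v, w} : Set ℕ), s(z, a) ∈ S ∧ s(z, b) ∈ S := by
    rintro z (rfl | rfl | rfl) <;> simp [hS]
  have hz : ∀ z ∈ ({u, v, w} : Set ℕ), z < n.1 ∧ z ∉ X := by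
    rintro z (rfl | rfl | rfl) <;> exact ⟨by assumption, by assumption⟩
  have hbc33 : biclique {a, b, c} {u, v, w} ⊆ (M n).closure S := by
    rintro _ ⟨x, hx, z, hzm, rfl⟩
    rw [Sym2.eq_swap]
    rcases hx with rfl | rfl | rfl
    · exact hScl (hstar z hzm).1
    · exact hScl (hstar z hzm).2
    · refine (M n).closure_subset_closure ?_ (hM.mem_closure_of_not_indep_star hX hu huX
        (hz z hzm).1 (hz z hzm).2 ha hb hc hab hHX hHi hdep)
      exact Set.insert_subset (hstar z hzm).1 (Set.insert_subset (hstar z hzm).2 hHS)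
  -- The nine edges of the independent `K_{3,3}` form a basis of the clique on its six vertices, so
  -- they span `ab`.
  have habS : s(a, b) ∈ (M n).closure S := by
    set Y : Finset ℕ := {a, b, c, u, v, w} with hY
    have hYX : Y ⊆ Finset.range n.1 := by
      simp only [hY, Finset.insert_subset_iff, Finset.singleton_subset_iff]
      exact ⟨hX ha, hX hb, hX hc, by simpa using hu, by simpa using hv, by simpa using hw⟩
    have hne := fun z hz x hx => (hneX z hz x hx).symm
    have hYc : Y.card = 6 := by
      simp [hY, hab, hac, hbc, huv, huw, hvw, hne u huX a ha, hne u huX b hb, hne u huX c hc,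
        hne v hvX a ha, hne v hvX b hb, hne v hvX c hc, hne w hwX a ha, hne w hwX b hb,
        hne w hwX c hc]
    have hBY : biclique {a, b, c} {u, v, w} ⊆ clique Y := by
      rintro _ ⟨x, hx, z, hzm, rfl⟩
      have hxX : x ∈ X := by rcases hx with rfl | rfl | rfl <;> assumption
      refine mk_mem_clique.2 ⟨hne z (hz z hzm).2 x hxX, ?_, ?_⟩
      · rcases hx with rfl | rfl | rfl <;> simp [hY]
      · rcases hzm with rfl | rfl | rfl <;> simp [hY]
    have hB9 : biclique {a, b, c} {u, v, w} = {s(a, u), s(a, v), s(a, w), s(b, u), s(b, v),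
        s(b, w), s(c, u), s(c, v), s(c, w)} := by
      ext e
      simp [biclique, or_assoc]
    have hcard : (biclique {a, b, c} {u, v, w}).encard = 9 := by
      have h1 := hne u huX a ha
      have h2 := hne u huX b hb
      have h3 := hne u huX c hc
      have h4 := hne v hvX a ha
      have h5 := hne v hvX b hb
      have h6 := hne v hvX c hc
      have h7 := hne w hwX a ha
      have h8 := hne w hwX b hb
      have h9 := hne w hwX c hc
      rw [hB9]
      repeat rw [Set.encard_insert_of_notMem (by simp; grind)]
      rw [Set.encard_singleton]
      norm_num
    have hbas : (M n).IsBasis (biclique {a, b, c} {u, v, w}) (clique Y) := by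
      refine h33.isBasis_of_eRk_ge ((clique_finite Y).subset hBY) hBY ?_
        (hM.clique_subset_ground hYX)
      rw [hM.eRk_clique hYX (by omega), h33.eRk_eq_encard, hcard, hYc]
      norm_num
    exact (M n).closure_subset_closure_of_subset_closure hbc33
      (hbas.subset_closure (mk_mem_clique.2 ⟨hab, by simp [hY], by simp [hY]⟩))
  have hJS : J ⊆ (M n).closure S := by
    intro e he
    by_cases h : e = s(a, b)
    · rwa [h]
    · exact hScl (hHS ⟨he, h⟩)
  have hXS : clique X ⊆ (M n).closure S :=
    hJ.subset_closure.trans ((M n).closure_subset_closure_of_subset_closure hJS)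
  have hS1 := hM.clique_insert_subset_closure hX hw hwX ha hb hab hXS
    (hScl (hstar w (by simp)).1) (hScl (hstar w (by simp)).2)
  have hS2 := hM.clique_insert_subset_closure hXw hv (by simp [hvX, hvw])
    (Finset.mem_insert_of_mem ha) (Finset.mem_insert_of_mem hb) hab hS1
    (hScl (hstar v (by simp)).1) (hScl (hstar v (by simp)).2)
  have hS3 := hM.clique_insert_subset_closure hXvw hu (by simp [huX, huv, huw])
    (Finset.mem_insert_of_mem (Finset.mem_insert_of_mem ha))
    (Finset.mem_insert_of_mem (Finset.mem_insert_of_mem hb)) hab hS2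
    (hScl (hstar u (by simp)).1) (hScl (hstar u (by simp)).2)
  have hcard : (insert u (insert v (insert w X))).card = X.card + 3 := by
    rw [Finset.card_insert_of_notMem (by simp [huX, huv, huw]),
      Finset.card_insert_of_notMem (by simp [hvX, hvw]), Finset.card_insert_of_notMem hwX]
  have hle := hM.le_encard_of_clique_subset_closure hXuvw (by omega) hS3
  have hHc : H.encard = ((2 * X.card - 4 : ℕ) : ℕ∞) := by
    have h1 := Set.encard_sdiff_singleton_add_one (s := J) (a := s(a, b)) (hGJ (by simp))
    rw [hJ.encard_eq_eRk, hM.eRk_clique hX h2] at h1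
    have h3 : ((2 * X.card - 3 : ℕ) : ℕ∞) = ((2 * X.card - 4 : ℕ) : ℕ∞) + 1 := by
      exact_mod_cast (by omega)
    rw [h3] at h1
    exact WithTop.add_right_cancel (ENat.natCast_ne_top 1) h1
  have hSc : S.encard ≤ H.encard + 1 + 1 + 1 + 1 + 1 + 1 := by
    iterate 6 refine (Set.encard_insert_le _ _).trans ?_; gcongr
  have := (hle.trans ((M n).eRk_le_encard S)).trans hSc
  rw [hHc, hcard] at this
  norm_cast at this
  omega

end IsTwoRigidityFamily
end PlaneRigidity

/-! ### Laman graphs and the plane rigidity family -/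

namespace PlaneRigidity

theorem induced_subset_clique {n : ℕ} {G : Set (Sym2 ℕ)} (hG : G ⊆ completeEdges n)
    (X : Finset ℕ) : induced G X ⊆ clique X :=
  fun _ he => ⟨(hG he.1).1, he.2⟩

theorem IsLaman.ncard_induced_le {n : ℕ} {G : Set (Sym2 ℕ)} (hG : IsLaman n G) {X : Finset ℕ}
    (h2 : 2 ≤ X.card) : (induced G X).ncard ≤ 2 * X.card - 3 := by
  have hsub : induced G X ⊆ induced G (X ∩ Finset.range n) := fun e he =>
    ⟨he.1, fun v hv => Finset.mem_inter.2 ⟨he.2 v hv, by simpa using (hG.1 he.1).2 v hv⟩⟩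
  have hfin : ∀ Y, (induced G Y).Finite := fun Y =>
    (clique_finite Y).subset (induced_subset_clique hG.1 Y)
  have hle := Set.ncard_le_ncard hsub (hfin _)
  have hc := Finset.card_le_card (Finset.inter_subset_left : X ∩ Finset.range n ⊆ X)
  rcases Set.eq_empty_or_nonempty (induced G (X ∩ Finset.range n)) with h | ⟨e, he⟩
  · rw [h, Set.ncard_empty] at hle
    omega
  · have hc2 := two_le_card_of_edge (hG.1 he.1).1 he.2
    have := hG.2 _ Finset.inter_subset_right hc2
    omega

theorem vertices_mono {G H : Set (Sym2 ℕ)} (h : G ⊆ H) : vertices G ⊆ vertices H :=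
  fun _ ⟨e, he, hv⟩ => ⟨e, h he, hv⟩

theorem IsLaman.of_isCopy {m n : ℕ} {G G' : Set (Sym2 ℕ)} (hG : IsLaman m G) (h : IsCopy G G')
    (hG' : G' ⊆ completeEdges n) : IsLaman n G' := by
  refine ⟨hG', fun X _ h2 => ?_⟩
  obtain ⟨f, hf, rfl⟩ := h.symm
  have hcard := (injOn_sym2_map (hf.mono (vertices_mono (induced_subset G' X)))).ncard_image
  rw [← hcard]
  have hsub : Sym2.map f '' induced G' X ⊆ induced (Sym2.map f '' G') (X.image f) := by
    rintro _ ⟨e, he, rfl⟩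
    refine ⟨⟨e, he.1, rfl⟩, fun v hv => ?_⟩
    obtain ⟨w, hw, rfl⟩ := Sym2.mem_map.1 hv
    exact Finset.mem_image_of_mem f (he.2 w hw)
  have hfin : (induced (Sym2.map f '' G') (X.image f)).Finite :=
    (clique_finite _).subset (induced_subset_clique hG.1 _)
  have hle := Set.ncard_le_ncard hsub hfin
  have hc1 : (X.image f).card ≤ X.card := Finset.card_image_le
  -- `f` need not be injective on all of `X`, so the image may have fewer than two points; then it
  -- induces no edges.
  rcases Set.eq_empty_or_nonempty (induced (Sym2.map f '' G') (X.image f)) with h | ⟨e, he⟩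
  · rw [h, Set.ncard_empty] at hle
    omega
  · have := hG.ncard_induced_le (two_le_card_of_edge (hG.1 he.1).1 he.2)
    omega

/-- The witness is the edge `01` together with all edges from 0 and 1 to the other vertices. It
gives the lower bound on the rank of the rigidity matroid. -/
theorem exists_isLaman_ncard_eq {n : ℕ} (hn : 2 ≤ n) :
    ∃ G, IsLaman n G ∧ G.ncard = 2 * n - 3 := by
  classical
  set A : Finset (Sym2 ℕ) := (Finset.Ico 1 n).image fun i => s(0, i) with hA
  set B : Finset (Sym2 ℕ) := (Finset.Ico 2 n).image fun i => s(1, i) with hB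
  refine ⟨(A ∪ B : Finset (Sym2 ℕ)), ⟨?_, fun X _ h2 => ?_⟩, ?_⟩
  · intro e he
    rw [completeEdges_eq_clique]
    rcases Finset.mem_union.1 (Finset.mem_coe.1 he) with he | he <;>
      obtain ⟨i, hi, rfl⟩ := Finset.mem_image.1 he <;>
      rw [Finset.mem_Ico] at hi <;> rw [mk_mem_clique, Finset.mem_range, Finset.mem_range] <;> omega
  · have hsub : induced (A ∪ B : Finset (Sym2 ℕ)) X ⊆
        (((if 0 ∈ X then X.erase 0 else ∅).image fun i => s(0, i)) ∪
          ((if 1 ∈ X then (X.erase 0).erase 1 else ∅).image fun i => s(1, i)) :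
            Finset (Sym2 ℕ)) := by
      rintro e ⟨he, heX⟩
      rw [Finset.coe_union]
      rcases Finset.mem_union.1 (Finset.mem_coe.1 he) with he | he <;>
        obtain ⟨i, hi, rfl⟩ := Finset.mem_image.1 he <;> rw [Finset.mem_Ico] at hi
      · refine Or.inl (Finset.mem_coe.2 (Finset.mem_image_of_mem _ ?_))
        rw [if_pos (heX 0 (by simp)), Finset.mem_erase]
        exact ⟨by omega, heX i (by simp)⟩
      · refine Or.inr (Finset.mem_coe.2 (Finset.mem_image_of_mem _ ?_))
        rw [if_pos (heX 1 (by simp)), Finset.mem_erase, Finset.mem_erase]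
        exact ⟨by omega, by omega, heX i (by simp)⟩
    have hle := Set.ncard_le_ncard hsub (Finset.finite_toSet _)
    rw [Set.ncard_coe_finset] at hle
    refine hle.trans ((Finset.card_union_le _ _).trans
      ((add_le_add Finset.card_image_le Finset.card_image_le).trans ?_))
    by_cases h0 : 0 ∈ X <;> by_cases h1 : 1 ∈ X
    · rw [if_pos h0, if_pos h1, Finset.card_erase_of_mem (Finset.mem_erase.2 ⟨by simp, h1⟩),
        Finset.card_erase_of_mem h0]
      omega
    · rw [if_pos h0, if_neg h1, Finset.card_erase_of_mem h0, Finset.card_empty]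
      omega
    · rw [if_neg h0, if_pos h1, Finset.erase_eq_of_notMem h0, Finset.card_erase_of_mem h1,
        Finset.card_empty]
      omega
    · simp [h0, h1]
  · have hinj : ∀ a : ℕ, Function.Injective fun i : ℕ => s(a, i) := fun a i j h =>
      Sym2.congr_right.1 h
    rw [Set.ncard_coe_finset, Finset.card_union_of_disjoint, hA, hB,
      Finset.card_image_of_injective _ (hinj 0), Finset.card_image_of_injective _ (hinj 1),
      Nat.card_Ico, Nat.card_Ico]
    · omega
    · rw [Finset.disjoint_left]
      intro e heA heB
      obtain ⟨i, hi, rfl⟩ := Finset.mem_image.1 heA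
      obtain ⟨j, hj, h⟩ := Finset.mem_image.1 heB
      rw [Finset.mem_Ico] at hi hj
      simp only [Sym2.eq_iff] at h
      omega

theorem isTwoRigidityFamily_rigidityFamily : IsTwoRigidityFamily rigidityFamily := by
  refine ⟨⟨fun n => ⟨rfl, fun G G' hG h hG' => ?_⟩, ?_⟩, fun n => ?_⟩
  · rw [rigidityFamily, rigidityMatroid_indep_iff] at hG ⊢
    exact hG.of_isCopy h hG'
  · rintro G m n ⟨G₁, hGG₁, hG₁⟩ hle
    rw [rigidityFamily, rigidityMatroid_indep_iff] at hG₁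
    obtain ⟨f, hfX, hf⟩ := Set.Finite.exists_injOn_of_encard_le (s := vertices G)
      (t := (Finset.range n.1 : Set ℕ)) (Set.finite_of_encard_le_coe hle) (by
        rwa [Set.encard_coe_eq_coe_finsetCard, Finset.card_range])
    have hc : IsCopy G (Sym2.map f '' G) := ⟨f, hf, rfl⟩
    refine ⟨_, hc, ?_⟩
    rw [rigidityFamily, rigidityMatroid_indep_iff]
    refine hG₁.of_isCopy (hGG₁.symm.trans hc) ?_
    rw [completeEdges_eq_clique]
    rintro _ ⟨e, he, rfl⟩
    -- `G` is an arbitrary edge set; loops are excluded because a loop would survive in its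
    -- independent copy.
    have hdiag : ¬ e.IsDiag := by
      obtain ⟨g, -, rfl⟩ := hGG₁
      intro hd
      refine (hG₁.1 ⟨e, he, rfl⟩).1 ?_
      induction e with
      | h a b => simp_all
    induction e with
    | h a b =>
      have ha : a ∈ vertices G := ⟨_, he, by simp⟩
      have hb : b ∈ vertices G := ⟨_, he, by simp⟩
      rw [Sym2.map_mk, mk_mem_clique]
      exact ⟨fun h => hdiag (by simpa using hf ha hb h), by simpa using hfX ha,
        by simpa using hfX hb⟩
  · apply le_antisymm
    · obtain ⟨B, hB⟩ := (rigidityFamily n).exists_isBase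
      have hBL := hB.indep
      rw [rigidityFamily, rigidityMatroid_indep_iff] at hBL
      have h := hBL.2 (Finset.range n.1) subset_rfl (by simpa using n.2)
      have hBi : induced B (Finset.range n.1) = B :=
        Set.Subset.antisymm (induced_subset _ _) fun e he =>
          ⟨he, fun v hv => by simpa using (hBL.1 he).2 v hv⟩
      rw [hBi, Finset.card_range] at h
      rw [← hB.encard_eq_eRank, ← ((completeEdges_finite n.1).subset hBL.1).cast_ncard_eq]
      exact_mod_cast h
    · obtain ⟨G, hG, hc⟩ := exists_isLaman_ncard_eq n.2
      rw [← hc, ((completeEdges_finite n.1).subset hG.1).cast_ncard_eq]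
      refine Matroid.Indep.encard_le_eRank ?_
      rwa [rigidityFamily, rigidityMatroid_indep_iff]

/-- The degree sum is at most 2(2|X| - 3) < 4|X|. The set `D` is the neighbourhood of `v`. -/
theorem exists_degree_le_three {n : ℕ} {G : Set (Sym2 ℕ)} (hG : IsLaman n G) {X : Finset ℕ}
    (hGX : G ⊆ clique X) (h2 : 2 ≤ X.card) : ∃ v ∈ X, ∃ D ⊆ X.erase v, D.card ≤ 3 ∧
      G = {e ∈ G | v ∉ e} ∪ (fun u => s(v, u)) '' D := by
  classical
  have hfin : G.Finite := (clique_finite X).subset hGX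
  set F := hfin.toFinset with hF
  have hmem : ∀ e, e ∈ F ↔ e ∈ G := fun e => by simp [hF]
  have hFc : F.card ≤ 2 * X.card - 3 := by
    rw [hF, ← Set.ncard_eq_toFinset_card G hfin]
    have hGi : induced G X = G :=
      Set.Subset.antisymm (induced_subset _ _) fun e he => ⟨he, (hGX he).2⟩
    exact hGi ▸ hG.ncard_induced_le h2
  have hsum : ∑ v ∈ X, (Finset.bipartiteAbove (fun (v : ℕ) (e : Sym2 ℕ) => v ∈ e) F v).card
      < ∑ v ∈ X, 4 := by
    rw [Finset.sum_card_bipartiteAbove_eq_sum_card_bipartiteBelow]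
    calc _ ≤ ∑ e ∈ F, 2 := by
          refine Finset.sum_le_sum fun e he => ?_
          have hd := (hGX ((hmem e).1 he)).1
          rw [← Sym2.card_toFinset_of_not_isDiag e hd]
          refine Finset.card_le_card fun v hv => ?_
          simpa using ((Finset.mem_bipartiteBelow _).1 hv).2
      _ < _ := by
          rw [Finset.sum_const, Finset.sum_const, smul_eq_mul, smul_eq_mul]
          omega
  obtain ⟨v, hv, hlt⟩ := Finset.exists_lt_of_sum_lt hsum
  refine ⟨v, hv, (X.erase v).filter fun u => s(v, u) ∈ G, Finset.filter_subset _ _, ?_, ?_⟩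
  · refine le_trans ?_ (Nat.lt_succ_iff.1 hlt)
    refine Finset.card_le_card_of_injOn (fun u => s(v, u)) ?_ fun i _ j _ h => Sym2.congr_right.1 h
    intro u hu
    have hu' := (Finset.mem_filter.1 (Finset.mem_coe.1 hu)).2
    exact Finset.mem_coe.2 ((Finset.mem_bipartiteAbove _).2 ⟨(hmem _).2 hu', by simp⟩)
  · ext e
    constructor
    · intro he
      by_cases hve : v ∈ e
      · obtain ⟨u, rfl⟩ := Sym2.mem_iff_exists.1 hve
        obtain ⟨h1, -, h3⟩ := mk_mem_clique.1 (hGX he)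
        exact Or.inr ⟨u, by simpa using ⟨⟨h1.symm, h3⟩, he⟩, rfl⟩
      · exact Or.inl ⟨he, hve⟩
    · rintro (he | ⟨u, hu, rfl⟩)
      · exact he.1
      · exact (Finset.mem_filter.1 (Finset.mem_coe.1 hu)).2

theorem isLaman_K33 : IsLaman 6 K33 := by
  classical
  have hsub : K33 ⊆ completeEdges 6 := by
    rintro _ ⟨i, j, hi, hj, hj', rfl⟩
    rw [completeEdges_eq_clique, mk_mem_clique, Finset.mem_range, Finset.mem_range]
    omega
  refine ⟨hsub, fun X hX h2 => ?_⟩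
  set A := X.filter (· < 3) with hA
  set B := X.filter (¬ · < 3) with hB
  have hAB : A.card + B.card = X.card := Finset.card_filter_add_card_filter_not _
  have hA3 : A.card ≤ 3 := by
    have : A ⊆ Finset.range 3 := fun x hx => by simpa using (Finset.mem_filter.1 hx).2
    simpa using Finset.card_le_card this
  have hB3 : B.card ≤ 3 := by
    have : B ⊆ Finset.Ico 3 6 := fun x hx => by
      have h1 := hX (Finset.mem_filter.1 hx).1
      have h2 := (Finset.mem_filter.1 hx).2
      rw [Finset.mem_range] at h1
      rw [Finset.mem_Ico]
      omega
    simpa using Finset.card_le_card this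
  have hle : (induced K33 X).ncard ≤ A.card * B.card := by
    rw [← Finset.card_product]
    refine le_trans ?_ (Finset.card_image_le (s := A ×ˢ B) (f := fun p => s(p.1, p.2)))
    rw [← Set.ncard_coe_finset]
    refine Set.ncard_le_ncard ?_ (Finset.finite_toSet _)
    rintro _ ⟨⟨i, j, hi, hj, hj', rfl⟩, hX⟩
    refine Finset.mem_coe.2 (Finset.mem_image.2 ⟨(i, j), Finset.mem_product.2 ⟨?_, ?_⟩, rfl⟩)
    · exact Finset.mem_filter.2 ⟨hX i (by simp), hi⟩
    · exact Finset.mem_filter.2 ⟨hX j (by simp), by omega⟩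
  refine hle.trans ?_
  generalize A.card = a at *
  generalize B.card = b at *
  -- The inequality ab ≤ 2(a + b) - 3 says (a - 2)(b - 2) ≤ 1, which holds when a, b ≤ 3 and a + b ≥
  -- 2.
  interval_cases a <;> omega

theorem K33_eq_biclique : K33 = biclique {0, 1, 2} {3, 4, 5} := by
  ext e
  constructor
  · rintro ⟨i, j, hi, hj, hj', rfl⟩
    refine mk_mem_biclique ?_ ?_
    · simp only [Set.mem_insert_iff, Set.mem_singleton_iff]; omega
    · simp only [Set.mem_insert_iff, Set.mem_singleton_iff]; omega
  · rintro ⟨i, hi, j, hj, rfl⟩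
    simp only [Set.mem_insert_iff, Set.mem_singleton_iff] at hi hj
    exact ⟨i, j, by omega, by omega, by omega, rfl⟩

end PlaneRigidity

/-! ### The `K_{3,3}` dichotomy and Henneberg induction -/

namespace PlaneRigidity

theorem isCopy_K33_biclique {a b c u v w : ℕ} (h : [a, b, c, u, v, w].Nodup) :
    IsCopy K33 (biclique {a, b, c} {u, v, w}) := by
  -- The default 0 is harmless: a copy needs injectivity only on the vertices 0, …, 5.
  refine ⟨fun k => [a, b, c, u, v, w].getD k 0, ?_, ?_⟩
  · have hv : ∀ x ∈ vertices K33, x < 6 := by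
      rintro x ⟨e, he, hx⟩
      exact (isLaman_K33.1 he).2 x hx
    intro x hx y hy hxy
    have hx6 := hv x hx
    have hy6 := hv y hy
    simp only [List.getD_eq_getElem _ _ (show x < [a, b, c, u, v, w].length from hx6),
      List.getD_eq_getElem _ _ (show y < [a, b, c, u, v, w].length from hy6)] at hxy
    exact (h.getElem_inj_iff).1 hxy
  · rw [K33_eq_biclique, map_biclique]
    simp [Set.image_insert_eq]

theorem exists_eq_biclique_of_isCopy_K33 {G : Set (Sym2 ℕ)} (h : IsCopy K33 G) :
    ∃ A B : Finset ℕ, A.card = 3 ∧ B.card = 3 ∧ Disjoint A B ∧ G = biclique A B := by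
  obtain ⟨f, hf, rfl⟩ := h
  have hl : ∀ i < 3, i ∈ vertices K33 := fun i hi =>
    ⟨s(i, 3), ⟨i, 3, hi, le_rfl, by norm_num, rfl⟩, by simp⟩
  have hr : ∀ j, 3 ≤ j → j < 6 → j ∈ vertices K33 := fun j hj hj' =>
    ⟨s(0, j), ⟨0, j, by norm_num, hj, hj', rfl⟩, by simp⟩
  have hL : ∀ i ∈ ({0, 1, 2} : Finset ℕ), i < 3 := by simp
  have hR : ∀ j ∈ ({3, 4, 5} : Finset ℕ), 3 ≤ j ∧ j < 6 := by simp
  refine ⟨Finset.image f {0, 1, 2}, Finset.image f {3, 4, 5}, ?_, ?_, ?_, ?_⟩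
  · exact Finset.card_image_of_injOn (hf.mono fun i hi => hl i (hL i hi))
  · exact Finset.card_image_of_injOn (hf.mono fun j hj => hr j (hR j hj).1 (hR j hj).2)
  · rw [Finset.disjoint_left]
    intro x hx hx'
    obtain ⟨i, hi, rfl⟩ := Finset.mem_image.1 hx
    obtain ⟨j, hj, hij⟩ := Finset.mem_image.1 hx'
    have h1 := hL i hi
    have h2 := hR j hj
    have := hf (hr j h2.1 h2.2) (hl i h1) hij
    omega
  · rw [K33_eq_biclique, map_biclique]
    simp [Set.image_insert_eq]

namespace IsTwoRigidityFamily

variable {M : {n : ℕ // 2 ≤ n} → Matroid (Sym2 ℕ)} (hM : IsTwoRigidityFamily M)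
  {n : {n : ℕ // 2 ≤ n}}

include hM

/-- Four 0-extensions build it: starting from no edges, each vertex of `B` is joined to the two
vertices of `A` other than `a`, then `a` to the two vertices of `B` other than `u`. -/
theorem indep_biclique_sdiff_singleton {A B : Finset ℕ} (hA : A.card = 3) (hB : B.card = 3)
    (hAB : Disjoint A B) (hAn : A ⊆ Finset.range n.1) (hBn : B ⊆ Finset.range n.1) {a u : ℕ}
    (ha : a ∈ A) (hu : u ∈ B) : (M n).Indep (biclique A B \ {s(a, u)}) := by
  obtain ⟨b, c, hbc, hA'⟩ := Finset.card_eq_two.1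
    (show (A.erase a).card = 2 by rw [Finset.card_erase_of_mem ha, hA])
  obtain ⟨v, w, hvw, hB'⟩ := Finset.card_eq_two.1
    (show (B.erase u).card = 2 by rw [Finset.card_erase_of_mem hu, hB])
  have hne : ∀ x ∈ A, ∀ y ∈ B, x ≠ y := fun x hx y hy h =>
    Finset.disjoint_left.1 hAB hx (h ▸ hy)
  have hbm : b ∈ A.erase a := by simp [hA']
  have hcm : c ∈ A.erase a := by simp [hA']
  have hvm : v ∈ B.erase u := by simp [hB']
  have hwm : w ∈ B.erase u := by simp [hB']
  obtain ⟨hba, hb⟩ := Finset.mem_erase.1 hbm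
  obtain ⟨hca, hc⟩ := Finset.mem_erase.1 hcm
  obtain ⟨hvu, hv⟩ := Finset.mem_erase.1 hvm
  obtain ⟨hwu, hw⟩ := Finset.mem_erase.1 hwm
  have hAl : ∀ x ∈ A, x < n.1 := fun x hx => by simpa using hAn hx
  have hBl : ∀ x ∈ B, x < n.1 := fun x hx => by simpa using hBn hx
  have hXn : ({w, v, u, b, c} : Finset ℕ) ⊆ Finset.range n.1 := by
    simp [Finset.insert_subset_iff, hAl b hb, hAl c hc, hBl v hv, hBl w hw, hBl u hu]
  have hXn1 : ({v, u, b, c} : Finset ℕ) ⊆ Finset.range n.1 := (Finset.subset_insert _ _).trans hXn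
  have hXn2 : ({u, b, c} : Finset ℕ) ⊆ Finset.range n.1 := (Finset.subset_insert _ _).trans hXn1
  have hXn3 : ({b, c} : Finset ℕ) ⊆ Finset.range n.1 := (Finset.subset_insert _ _).trans hXn2
  have hub := (hne b hb u hu).symm
  have huc := (hne c hc u hu).symm
  have hvb := (hne b hb v hv).symm
  have hvc := (hne c hc v hv).symm
  have hwb := (hne b hb w hw).symm
  have hwc := (hne c hc w hw).symm
  have s1 : insert s(u, b) (insert s(u, c) ∅) ⊆ clique {u, b, c} :=
    insert_mk_subset_clique (insert_mk_subset_clique (Set.empty_subset _) huc (by simp) (by simp))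
      hub (by simp) (by simp)
  have s2 : insert s(v, b) (insert s(v, c) (insert s(u, b) (insert s(u, c) ∅))) ⊆
      clique {v, u, b, c} :=
    insert_mk_subset_clique (insert_mk_subset_clique
      (s1.trans (clique_mono (Finset.subset_insert _ _))) hvc (by simp) (by simp))
      hvb (by simp) (by simp)
  have s3 : insert s(w, b) (insert s(w, c) (insert s(v, b) (insert s(v, c)
      (insert s(u, b) (insert s(u, c) ∅))))) ⊆ clique {w, v, u, b, c} :=
    insert_mk_subset_clique (insert_mk_subset_clique
      (s2.trans (clique_mono (Finset.subset_insert _ _))) hwc (by simp) (by simp))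
      hwb (by simp) (by simp)
  have i1 := hM.indep_zeroExtension hXn3 (hBl u hu) (by simp [hub, huc]) (by simp) (by simp) hbc
    (Set.empty_subset _) (M n).empty_indep
  have i2 := hM.indep_zeroExtension hXn2 (hBl v hv) (by simp [hvu, hvb, hvc]) (a := b) (b := c)
    (by simp) (by simp) hbc s1 i1
  have i3 := hM.indep_zeroExtension hXn1 (hBl w hw) (by simp [hvw.symm, hwu, hwb, hwc]) (a := b)
    (b := c) (by simp) (by simp) hbc s2 i2
  have i4 := hM.indep_zeroExtension hXn (hAl a ha) (v := a)
    (by simp [hne a ha u hu, hne a ha v hv, hne a ha w hw, hba.symm, hca.symm]) (a := v)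
    (b := w) (by simp) (by simp) hvw s3 i3
  refine i4.subset ?_
  rintro _ ⟨⟨x, hx, y, hy, rfl⟩, hxy⟩
  rw [← Finset.insert_erase ha, hA'] at hx
  rw [← Finset.insert_erase hu, hB'] at hy
  simp only [Finset.coe_insert, Finset.coe_singleton, Set.mem_insert_iff,
    Set.mem_singleton_iff] at hx hy
  rcases hx with rfl | rfl | rfl <;> rcases hy with rfl | rfl | rfl <;> simp_all

theorem isCircuit_of_isCopy_K33 {G : Set (Sym2 ℕ)} (h : IsCopy K33 G)
    (hG : G ⊆ completeEdges n.1) (hdep : ¬ (M n).Indep G) : (M n).IsCircuit G := by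
  obtain ⟨A, B, hA, hB, hAB, rfl⟩ := exists_eq_biclique_of_isCopy_K33 h
  obtain ⟨a₀, ha₀⟩ := Finset.card_pos.1 (show 0 < A.card by omega)
  obtain ⟨b₀, hb₀⟩ := Finset.card_pos.1 (show 0 < B.card by omega)
  rw [Matroid.isCircuit_iff_dep_forall_sdiff_singleton_indep]
  refine ⟨⟨hdep, hM.ground_eq n ▸ hG⟩, ?_⟩
  rintro _ ⟨a, ha, b, hb, rfl⟩
  refine hM.indep_biclique_sdiff_singleton hA hB hAB ?_ ?_ ha hb
  · exact fun x hx => by simpa using (hG (mk_mem_biclique hx hb₀)).2 x (by simp)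
  · exact fun x hx => by simpa using (hG (mk_mem_biclique ha₀ hx)).2 x (by simp)

/-- The Laman count is the rank bound on each clique. -/
theorem isLaman_of_indep {G : Set (Sym2 ℕ)} (hG : (M n).Indep G) : IsLaman n.1 G := by
  have hsub : G ⊆ completeEdges n.1 := hM.ground_eq n ▸ hG.subset_ground
  refine ⟨hsub, fun X hX h2 => ?_⟩
  have h := (hG.subset (induced_subset G X)).encard_le_eRk_of_subset
    (induced_subset_clique hsub X)
  rw [hM.eRk_clique hX h2,
    ← ((clique_finite X).subset (induced_subset_clique hsub X)).cast_ncard_eq] at h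
  exact_mod_cast h

theorem indep_of_card_le_two {X : Finset ℕ} (hX : X ⊆ Finset.range n.1) (h2 : X.card ≤ 2)
    {G : Set (Sym2 ℕ)} (hG : G ⊆ clique X) : (M n).Indep G := by
  rcases Set.eq_empty_or_nonempty G with rfl | ⟨e, he⟩
  · exact (M n).empty_indep
  have hX2 : X.card = 2 := le_antisymm h2 (two_le_card_of_edge (hG he).1 (hG he).2)
  refine Matroid.Indep.subset ?_ hG
  refine ((M n).isRkFinite_of_finite (clique_finite X)).indep_of_encard_le_eRk ?_
  rw [hM.eRk_clique hX hX2.ge, hX2]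
  obtain ⟨a, b, hab, rfl⟩ := Finset.card_eq_two.1 hX2
  have : clique {a, b} ⊆ {s(a, b)} := by
    intro e he
    induction e with
    | h p q =>
      obtain ⟨hpq, hp, hq⟩ := mk_mem_clique.1 he
      simp only [Finset.mem_insert, Finset.mem_singleton] at hp hq
      rcases hp with rfl | rfl <;> rcases hq with rfl | rfl <;> simp_all
  simpa using Set.encard_le_encard this

/-- Henneberg induction on `|X|`: a vertex `v` of degree at most 2 is restored by a 0-extension, one
of degree 3 by a 1-extension across a pair of its neighbours not yet rigidly linked. -/
theorem indep_of_isLaman {m : {n : ℕ // 2 ≤ n}} (h33 : (M m).Indep K33) (X : Finset ℕ)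
    (hX : X ⊆ Finset.range n.1) {G : Set (Sym2 ℕ)} (hGX : G ⊆ clique X) (hG : IsLaman n.1 G) :
    (M n).Indep G := by
  induction hk : X.card using Nat.strong_induction_on generalizing X G with
  | _ k ih =>
  subst hk
  rcases le_or_gt X.card 2 with h2 | h3
  · exact hM.indep_of_card_le_two hX h2 hGX
  obtain ⟨v, hvX, D, hD, hD3, hGD⟩ := exists_degree_le_three hG hGX (by omega)
  set H : Set (Sym2 ℕ) := {e ∈ G | v ∉ e} with hH
  have hHG : H ⊆ G := fun _ he => he.1
  have hHX : H ⊆ clique (X.erase v) := fun e he => ⟨(hGX he.1).1, fun x hx =>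
    Finset.mem_erase.2 ⟨fun h => he.2 (h ▸ hx), (hGX he.1).2 x hx⟩⟩
  have hcard : (X.erase v).card < X.card := Finset.card_erase_lt_of_mem hvX
  have hXn : X.erase v ⊆ Finset.range n.1 := (Finset.erase_subset _ _).trans hX
  have hvn : v < n.1 := by simpa using hX hvX
  have hH_laman : IsLaman n.1 H := hG.subset hHG
  rcases Nat.lt_or_ge D.card 3 with hD2 | hD3'
  -- The neighbourhood is padded to exactly two vertices; the surplus edges are dropped afterwards.
  · obtain ⟨D', hDD', hD'X, hD'⟩ := Finset.exists_subsuperset_card_eq hD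
      (Nat.lt_succ_iff.1 hD2) (by rw [Finset.card_erase_of_mem hvX]; omega)
    obtain ⟨a, b, hab, rfl⟩ := Finset.card_eq_two.1 hD'
    refine (hM.indep_zeroExtension hXn hvn (Finset.notMem_erase v X) (hD'X (by simp))
      (hD'X (by simp)) hab hHX (ih _ hcard _ hXn hHX hH_laman rfl)).subset ?_
    rw [hGD]
    refine Set.union_subset (fun e he => by simp [he]) ?_
    rintro _ ⟨x, hx, rfl⟩
    have := hDD' hx
    simp only [Finset.mem_insert, Finset.mem_singleton] at this
    rcases this with rfl | rfl <;> simp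
  obtain ⟨a, b, c, hab, hac, hbc, rfl⟩ := Finset.card_eq_three.1 (le_antisymm hD3 hD3')
  -- If `xy` is outside the rigidity closure of `H`, then `H + xy` is Laman, hence independent in `M
  -- n` by induction, and the 1-extension recovers `G`.
  have step : ∀ x y z : ℕ, ({a, b, c} : Finset ℕ) = {x, y, z} → x ≠ y → x ≠ z → y ≠ z →
      s(x, y) ∉ (rigidityFamily n).closure H → (M n).Indep G := by
    intro x y z hxyz hxy hxz hyz hcl
    rw [hxyz] at hD hGD
    have hx : x ∈ X.erase v := hD (by simp)
    have hy : y ∈ X.erase v := hD (by simp)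
    have hz : z ∈ X.erase v := hD (by simp)
    have hHR : (rigidityFamily n).Indep H := (rigidityMatroid_indep_iff _ _).2 hH_laman
    have hins := ((hHR.notMem_closure_iff (isTwoRigidityFamily_rigidityFamily.clique_subset_ground
      hXn (mk_mem_clique.2 ⟨hxy, hx, hy⟩))).1 hcl)
    have hHi := ih _ hcard _ hXn (insert_mk_subset_clique hHX hxy hx hy)
      ((rigidityMatroid_indep_iff _ _).1 hins.1) rfl
    -- Two extra vertices `n` and `n + 1` make room for the clones of `v`; independence is brought
    -- back to `M n` by heredity.
    set N : {n : ℕ // 2 ≤ n} := ⟨n.1 + 2, by omega⟩ with hN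
    have hnN : Finset.range n.1 ⊆ Finset.range N.1 := Finset.range_mono (by simp [hN])
    have hHN : (M N).Indep (insert s(x, y) H) := hM.indep_of_isCopy hHi (isCopy_refl _)
      ((insert_mk_subset_clique hHX hxy hx hy).trans
        (clique_subset_completeEdges (hXn.trans hnN)))
    have hlt : ∀ t ∈ X.erase v, t < n.1 := fun t ht => by simpa using hXn ht
    have hxn := hlt x hx
    have hyn := hlt y hy
    have hzn := hlt z hz
    have hne : ∀ t ∈ X.erase v, t ≠ v := fun t ht => Finset.ne_of_mem_erase ht
    have hnodup : [x, y, z, v, n.1, n.1 + 1].Nodup := by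
      have := hne x hx
      have := hne y hy
      have := hne z hz
      simp
      omega
    have hK : (M N).Indep (biclique {x, y, z} {v, n.1, n.1 + 1}) := by
      refine hM.indep_of_isCopy h33 (isCopy_K33_biclique hnodup) ?_
      rintro _ ⟨s, hs, t, ht, rfl⟩
      have hsX : s ∈ X.erase v := by rcases hs with rfl | rfl | rfl <;> assumption
      have h1 := hlt s hsX
      have h2 := hne s hsX
      rw [completeEdges_eq_clique, mk_mem_clique, Finset.mem_range, Finset.mem_range]
      simp only [Set.mem_insert_iff, Set.mem_singleton_iff] at ht
      simp only [hN]
      omega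
    have hext := hM.indep_oneExtension (hXn.trans hnN) (u := v) (v := n.1) (w := n.1 + 1)
      (by simp only [hN]; omega) (by simp only [hN]; omega) (by simp only [hN]; omega)
      (Finset.notMem_erase v X) (fun h => (hlt _ h).false)
      (fun h => by have := hlt _ h; omega) hvn.ne (by omega) (by omega) hx hy hz hxy hxz hyz hHX
      hins.2 hHN hK
    refine hM.indep_of_isCopy (hext.subset ?_) (isCopy_refl _) hG.1
    rw [hGD]
    refine Set.union_subset (fun e he => by simp [he]) ?_
    rintro _ ⟨t, ht, rfl⟩
    simp only [Finset.coe_insert, Finset.coe_singleton, Set.mem_insert_iff,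
      Set.mem_singleton_iff] at ht
    rcases ht with rfl | rfl | rfl <;> simp
  by_cases h1 : s(a, b) ∈ (rigidityFamily n).closure H
  swap
  · exact step a b c rfl hab hac hbc h1
  by_cases h2 : s(c, a) ∈ (rigidityFamily n).closure H
  swap
  · exact step c a b (by ext; simp; tauto) hac.symm hbc.symm hab h2
  by_cases h3 : s(c, b) ∈ (rigidityFamily n).closure H
  swap
  · exact step c b a (by ext; simp; tauto) hbc.symm hac.symm hab.symm h3
  -- If all three pairs were in the rigidity closure of `H`, the `K_4` on `v, a, b, c` would put
  -- `vc` in the closure of `H + va + vb`, contradicting independence of `G` in the rigidity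
  -- matroid.
  exfalso
  have ha : a ∈ X.erase v := hD (by simp)
  have hb : b ∈ X.erase v := hD (by simp)
  have hc : c ∈ X.erase v := hD (by simp)
  have hva : v ≠ a := (Finset.ne_of_mem_erase ha).symm
  have hvb : v ≠ b := (Finset.ne_of_mem_erase hb).symm
  have hvc : v ≠ c := (Finset.ne_of_mem_erase hc).symm
  have hGR : (rigidityFamily n).Indep G := (rigidityMatroid_indep_iff _ _).2 hG
  set T : Set (Sym2 ℕ) := insert s(v, a) (insert s(v, b) H) with hT
  have hmemG : ∀ x ∈ ({a, b, c} : Finset ℕ), s(v, x) ∈ G := fun x hx => by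
    rw [hGD]
    exact Or.inr ⟨x, hx, rfl⟩
  have hTG : T ⊆ G \ {s(v, c)} := by
    rintro e (rfl | rfl | he)
    · exact ⟨hmemG a (by simp), fun h => hac (Sym2.congr_right.1 h)⟩
    · exact ⟨hmemG b (by simp), fun h => hbc (Sym2.congr_right.1 h)⟩
    · exact ⟨hHG he, fun h => he.2 (by rw [Set.mem_singleton_iff.1 h]; simp)⟩
  have hTcl := (rigidityFamily n).subset_closure T
    ((hTG.trans Set.sdiff_subset).trans hGR.subset_ground)
  have hHT : H ⊆ T := (Set.subset_insert _ _).trans (Set.subset_insert _ _)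
  have hHTcl := (rigidityFamily n).closure_subset_closure hHT
  refine hGR.notMem_closure_sdiff_of_mem (hmemG c (by simp))
    ((rigidityFamily n).closure_subset_closure hTG ?_)
  refine (rigidityFamily n).closure_subset_closure_of_subset_closure ?_
    (isTwoRigidityFamily_rigidityFamily.mk_mem_closure_of_four (n := n) (a := v) (b := c) (c := a)
      (d := b) ?_ hvc hva hvb hac.symm hbc.symm hab)
  · rintro e (rfl | rfl | rfl | rfl | rfl)
    · exact hTcl (by simp [hT])
    · exact hTcl (by simp [hT])
    · exact hHTcl h2
    · exact hHTcl h3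
    · exact hHTcl h1
  · simp only [Finset.insert_subset_iff, Finset.singleton_subset_iff]
    exact ⟨hX hvX, hXn hc, hXn ha, hXn hb⟩

theorem eq_rigidityFamily (h : ¬ IsFamilyCircuit M K33) : M = rigidityFamily := by
  simp only [IsFamilyCircuit, not_forall] at h
  obtain ⟨m, G, hc, hG, hcirc⟩ := h
  have hi : (M m).Indep G := by
    by_contra hdep
    exact hcirc (hM.isCircuit_of_isCopy_K33 hc hG hdep)
  have h33 : (M ⟨6, by norm_num⟩).Indep K33 := hM.indep_of_isCopy hi hc.symm isLaman_K33.1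
  funext n
  refine Matroid.ext_indep (hM.ground_eq n) fun I hI => ?_
  rw [hM.ground_eq, completeEdges_eq_clique] at hI
  rw [rigidityFamily, rigidityMatroid_indep_iff]
  exact ⟨hM.isLaman_of_indep, hM.indep_of_isLaman h33 _ subset_rfl hI⟩

end IsTwoRigidityFamily

theorem not_isFamilyCircuit_rigidityFamily_K33 : ¬ IsFamilyCircuit rigidityFamily K33 := by
  intro h
  refine (h ⟨6, by norm_num⟩ K33 (isCopy_refl _) isLaman_K33.1).not_indep ?_
  rw [rigidityFamily, rigidityMatroid_indep_iff]
  exact isLaman_K33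

end PlaneRigidity

theorem theorem1 :
    (∀ M : {n : ℕ // 2 ≤ n} → Matroid (Sym2 ℕ),
      PlaneRigidity.IsTwoRigidityFamily M → M ≠ PlaneRigidity.rigidityFamily →
        PlaneRigidity.IsFamilyCircuit M PlaneRigidity.K33) ∧
    (∀ M : {n : ℕ // 2 ≤ n} → Matroid (Sym2 ℕ),
      (PlaneRigidity.IsTwoRigidityFamily M ∧
        ¬ PlaneRigidity.IsFamilyCircuit M PlaneRigidity.K33) ↔
          M = PlaneRigidity.rigidityFamily) := by
  refine ⟨fun M hM hne => ?_, fun M => ⟨fun h => h.1.eq_rigidityFamily h.2, ?_⟩⟩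
  · by_contra h
    exact hne (hM.eq_rigidityFamily h)
  · rintro rfl
    exact ⟨PlaneRigidity.isTwoRigidityFamily_rigidityFamily,
      PlaneRigidity.not_isFamilyCircuit_rigidityFamily_K33⟩
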